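/- Let $V$ be a finite-dimensional vector space over $\mathbb{C}$. Let $\mathfrak{sl}(V)$ be the Lie algebra of trace-zero endomorphisms of $V$, on which $SL(V)$ acts by the adjoint action $\mathrm{Ad}(g)(x)=gxg^{-1}$, and let $SL(V)$ act on the (complex) projective space $\mathbb{P}(\mathfrak{sl}(V))$ by the induced action. For a Borel probability measure $\mu$ on $SL(V)$, let $S_\mu$ (resp. $G_\mu$) denote the closed subsemigroup (resp. closed subgroup) of $SL(V)$ generated by the support of $\mu$, and call $\mu$ irreducible if $S_\mu=SL(V)$. Then $SL(V)$ has the Liouville property on $\mathbb{P}(\mathfrak{sl}(V))$. That is, for every irreducible Borel probability measure $\mu$ on $SL(V)$, every bounded continuous function $f\colon\mathbb{P}(\mathfrak{sl}(V))\to\mathbb{R}$ that satisfies $$\int_{SL(V)} f(gx)\,d\mu(g)=f(x)\qquad\text{for all }x\in\mathbb{P}(\mathfrak{sl}(V))$$ is $G_\mu$-invariant: $f(gx)=f(x)$ for all $g\in G_\mu$ and all $x\in\mathbb{P}(\mathfrak{sl}(V))$. -/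

import Mathlib

open MeasureTheory

open scoped LinearAlgebra.Projectivization

/-! ### Harmonic functions and the Liouville property for group actions -/

namespace GroupAction

section General

variable {G : Type*} [Group G] [TopologicalSpace G] [MeasurableSpace G]

/-- `S_μ`: the closed semigroup generated by the support of `μ`, that is, the smallest closed
subsemigroup of `G` containing the support of `μ`. -/
def closedSemigroup (μ : Measure G) : Subsemigroup G :=
  sInf {S : Subsemigroup G | IsClosed (S : Set G) ∧ μ.support ⊆ S}

/-- `G_μ`: the closed subgroup generated by the support of `μ`, that is, the smallest closed
subgroup of `G` containing the support of `μ`. -/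
def closedSubgroup (μ : Measure G) : Subgroup G :=
  sInf {H : Subgroup G | IsClosed (H : Set G) ∧ μ.support ⊆ H}

/-- `μ` is irreducible if `S_μ = G`. -/
def IsIrreducible (μ : Measure G) : Prop :=
  closedSemigroup μ = ⊤

variable {E : Type*} [MulAction G E]

/-- The mean value property: `∫ f (g x) dμ(g) = f x` for all `x`. -/
def HasMeanValueProperty (μ : Measure G) (f : E → ℝ) : Prop :=
  ∀ x : E, ∫ g, f (g • x) ∂μ = f x

/-- `μ` has the Liouville property on `E`: every bounded continuous `μ`-harmonic function on `E`
is `G_μ`-invariant. -/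
def HasLiouvilleProperty (μ : Measure G) (E : Type*) [TopologicalSpace E] [MulAction G E] :
    Prop :=
  ∀ f : E → ℝ, Continuous f → (∃ C : ℝ, ∀ x, |f x| ≤ C) → HasMeanValueProperty μ f →
    ∀ g ∈ closedSubgroup μ, ∀ x : E, f (g • x) = f x

end General

/-- `G` has the Liouville property on `E`: every irreducible probability measure on `G` has the
Liouville property on `E`. -/
def GroupHasLiouvilleProperty (G : Type*) [Group G] [TopologicalSpace G] [MeasurableSpace G]
    (E : Type*) [TopologicalSpace E] [MulAction G E] : Prop :=
  ∀ μ : Measure G, IsProbabilityMeasure μ → IsIrreducible μ → HasLiouvilleProperty μ E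

end GroupAction

/-! ### The projective space of a topological vector space -/

/-- The quotient topology on `ℙ(W)`, as a quotient of `W ∖ {0}`. -/
noncomputable instance projectivizationTopology (W : Type*) [AddCommGroup W] [Module ℂ W]
    [TopologicalSpace W] : TopologicalSpace (ℙ ℂ W) :=
  TopologicalSpace.coinduced (fun v : {v : W // v ≠ 0} => Projectivization.mk ℂ v.1 v.2)
    inferInstance

section SL

variable (V : Type*) [AddCommGroup V] [Module ℂ V]

/-! ### The topological group `SL(V)` -/

/-- The topology of `SL(V)` as a subset of `End(V)`. On the finite-dimensional space `End(V)`, the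
module topology is the usual vector space topology. -/
noncomputable instance specialLinearGroupTopology : TopologicalSpace (SpecialLinearGroup ℂ V) :=
  TopologicalSpace.induced
    (fun g => ((g : V ≃ₗ[ℂ] V) : Module.End ℂ V)) (moduleTopology ℂ (Module.End ℂ V))

/-- The Borel σ-algebra on `SL(V)`. -/
noncomputable instance specialLinearGroupMeasurableSpace : MeasurableSpace (SpecialLinearGroup ℂ V) :=
  borel (SpecialLinearGroup ℂ V)

instance specialLinearGroupBorelSpace : BorelSpace (SpecialLinearGroup ℂ V) := ⟨rfl⟩

/-! ### The Lie algebra `sl(V)` and the adjoint action -/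

/-- `sl(V)`: the space of endomorphisms of `V` of trace zero. Only the vector space structure of
the Lie algebra matters for the adjoint action and for `ℙ(sl(V))`. -/
noncomputable def slAlgebra : Submodule ℂ (Module.End ℂ V) :=
  LinearMap.ker (LinearMap.trace ℂ V)

variable {V} in
theorem mem_slAlgebra {x : Module.End ℂ V} : x ∈ slAlgebra V ↔ LinearMap.trace ℂ V x = 0 :=
  LinearMap.mem_ker

/-- The usual topology of the finite-dimensional vector space `sl(V)`. -/
noncomputable instance slAlgebraTopology : TopologicalSpace (slAlgebra V) :=
  moduleTopology ℂ (slAlgebra V)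

variable {V} in
/-- The adjoint action of `SL(V)` on `sl(V)`: `Ad(g)(x) = g x g⁻¹`. -/
noncomputable def adjointAct (g : SpecialLinearGroup ℂ V) (x : slAlgebra V) : slAlgebra V :=
  ⟨((g : V ≃ₗ[ℂ] V) : Module.End ℂ V) * (x : Module.End ℂ V) *
      (((g⁻¹ : SpecialLinearGroup ℂ V) : V ≃ₗ[ℂ] V) : Module.End ℂ V), by
    have h : (((g⁻¹ : SpecialLinearGroup ℂ V) : V ≃ₗ[ℂ] V) : Module.End ℂ V) *
        ((g : V ≃ₗ[ℂ] V) : Module.End ℂ V) = 1 := by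
      ext v
      exact (g : V ≃ₗ[ℂ] V).symm_apply_apply v
    rw [mem_slAlgebra, LinearMap.trace_mul_comm, ← mul_assoc, h, one_mul]
    exact mem_slAlgebra.mp x.2⟩

noncomputable instance adjointAction :
    DistribMulAction (SpecialLinearGroup ℂ V) (slAlgebra V) where
  smul := adjointAct
  one_smul x := Subtype.ext (LinearMap.ext fun _ => rfl)
  mul_smul g h x := Subtype.ext (LinearMap.ext fun _ => rfl)
  smul_zero g := Subtype.ext (by
    change _ * (0 : Module.End ℂ V) * _ = 0
    rw [mul_zero, zero_mul])
  smul_add g x y := Subtype.ext (by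
    change _ * ((x : Module.End ℂ V) + (y : Module.End ℂ V)) * _ = _ * _ * _ + _ * _ * _
    rw [mul_add, add_mul])

/-- The adjoint action is linear, so it induces Mathlib's action of `SL(V)` on `ℙ(sl(V))`. -/
instance adjointAction_smulCommClass :
    SMulCommClass (SpecialLinearGroup ℂ V) ℂ (slAlgebra V) where
  smul_comm g c x := Subtype.ext (by
    change _ * (c • (x : Module.End ℂ V)) * _ = c • (_ * _ * _)
    rw [mul_smul_comm, smul_mul_assoc])

end SL

/-!
The function `f` is in fact constant. Projective space is compact, so `f` attains a maximum and a
minimum. By the maximum principle, the set where `f` is maximal is stable under the support of `μ`,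
and, being closed, it is stable under `S_μ`, which is all of `SL(V)`
(`GroupAction.HasMeanValueProperty.apply_smul_eq_of_isMax`). The same holds for the set where `f`
is minimal. It remains to see that any two orbit closures in `ℙ(sl(V))` intersect.

Let `N = e ⊗ φ` be a nilpotent endomorphism of rank one, so `φ e = 0`. Conjugating `x` by the
transvection `1 + t N` gives `x + t [N, x] - t² φ(x e) N`. If `φ(x e) ≠ 0`, this tends to the line
of `N` as `t → ∞`, so `[N]` lies in the closure of the orbit of `[x]`
(`apply_mk_rankOne_eq_of_smul_invariant`). Nonzero elements of `sl(V)` are not scalar, and for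
finitely many non-scalar endomorphisms one pair `(e, φ)` serves all of them
(`exists_dual_apply_eq_zero_forall_apply_ne_zero`). Applied to
a maximum point `[x]` and a minimum point `[y]` of `f`, this shows that the maximum and the minimum
are both equal to the value of `f` at `[N]`.
-/

/-! ### The maximum principle -/

namespace GroupAction

section MaximumPrinciple

variable {G : Type*} [Group G] [TopologicalSpace G] [MeasurableSpace G] [BorelSpace G]
  {E : Type*} [TopologicalSpace E] [MulAction G E] {μ : Measure G} [IsProbabilityMeasure μ]
  {f : E → ℝ}

theorem HasMeanValueProperty.apply_smul_eq_of_mem_support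
    (hμ : HasMeanValueProperty μ f) (hsmul : ∀ x : E, Continuous fun g : G => g • x)
    (hf : Continuous f) (hbdd : ∃ C : ℝ, ∀ x, |f x| ≤ C) {x : E} (hx : ∀ y, f y ≤ f x)
    {g : G} (hg : g ∈ μ.support) : f (g • x) = f x := by
  have hcont : Continuous fun g : G => f (g • x) := hf.comp (hsmul x)
  obtain ⟨C, hC⟩ := hbdd
  have hint : Integrable (fun g : G => f (g • x)) μ :=
    Integrable.of_bound hcont.aestronglyMeasurable C (.of_forall fun g => hC _)
  have hzero : ∫ g, (f x - f (g • x)) ∂μ = 0 := by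
    rw [integral_sub (integrable_const _) hint, hμ x]
    simp
  have hae : (fun g : G => f x - f (g • x)) =ᵐ[μ] 0 :=
    (integral_eq_zero_iff_of_nonneg (fun g => sub_nonneg.2 (hx _))
      ((integrable_const _).sub hint)).1 hzero
  have hclosed : IsClosed {g : G | f (g • x) = f x} := isClosed_eq hcont continuous_const
  refine Measure.support_subset_of_isClosed hclosed ?_ hg
  filter_upwards [hae] with g hg
  exact (sub_eq_zero.1 hg).symm

/-- The maximum principle: for irreducible `μ`, the set of maximum points of a bounded continuous
`μ`-harmonic function is invariant under the whole group. -/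
theorem HasMeanValueProperty.apply_smul_eq_of_isMax
    (hμ : HasMeanValueProperty μ f) (hirr : IsIrreducible μ)
    (hsmul : ∀ x : E, Continuous fun g : G => g • x)
    (hf : Continuous f) (hbdd : ∃ C : ℝ, ∀ x, |f x| ≤ C) {x : E} (hx : ∀ y, f y ≤ f x)
    (g : G) : f (g • x) = f x := by
  let S : Subsemigroup G :=
    { carrier := {g | ∀ y, f y = f x → f (g • y) = f x}
      mul_mem' := fun {a b} ha hb y hy => by
        rw [mul_smul]
        exact ha _ (hb y hy) }
  have hS : IsClosed (S : Set G) := by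
    have : (S : Set G) = ⋂ y, ⋂ _ : f y = f x, {g | f (g • y) = f x} := by
      ext g
      simp only [Set.mem_iInter]
      rfl
    rw [this]
    exact isClosed_iInter fun y => isClosed_iInter fun _ =>
      isClosed_eq (hf.comp (hsmul y)) continuous_const
  have hsupp : μ.support ⊆ S := fun g hg y hy => by
    rw [← hy] at hx ⊢
    exact hμ.apply_smul_eq_of_mem_support hsmul hf hbdd hx hg
  have htop : closedSemigroup μ ≤ S := sInf_le ⟨hS, hsupp⟩
  rw [hirr] at htop
  exact htop (Subsemigroup.mem_top g) x rfl

end MaximumPrinciple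

end GroupAction

/-! ### Non-scalar endomorphisms -/

section Algebra

open Module

variable {K V ι : Type*} [Field K] [Infinite K] [AddCommGroup V] [Module K V]
  [FiniteDimensional K V] [Finite ι]

theorem exists_forall_notMem_span_singleton (x : ι → End K V)
    (hx : ∀ i c, x i ≠ algebraMap K (End K V) c) :
    ∃ e : V, ∀ i, x i e ∉ Submodule.span K {e} := by
  -- A vector outside the finitely many eigenspaces of the `x i`, all of which are proper, works.
  -- Each index `i` also contributes the subspace `⊥`, which makes `e` nonzero.
  obtain ⟨e, he⟩ := Submodule.exists_forall_notMem_of_forall_ne_top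
    (fun p : Σ i, Option (x i).Eigenvalues =>
      p.2.elim (⊥ : Submodule K V) fun c => (x p.1).eigenspace (c : K)) (by
      rintro ⟨i, _ | c⟩ hp
      · have := (Submodule.subsingleton_iff K).1 (subsingleton_of_bot_eq_top hp)
        exact hx i 0 (Subsingleton.elim _ _)
      · refine hx i c (LinearMap.ext fun v => ?_)
        rw [Module.algebraMap_end_apply]
        exact End.mem_eigenspace_iff.1 (hp.symm.le Submodule.mem_top))
  refine ⟨e, fun i hi => ?_⟩
  obtain ⟨c, hc⟩ := Submodule.mem_span_singleton.1 hi
  have hmem : e ∈ (x i).eigenspace c := End.mem_eigenspace_iff.2 hc.symm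
  exact he ⟨i, some ⟨c, End.hasEigenvalue_of_hasEigenvector ⟨hmem, he ⟨i, none⟩⟩⟩⟩ hmem

/-- For finitely many non-scalar endomorphisms `x i` there is an operator `e ⊗ φ` of rank one and
square zero such that `φ (x i e) ≠ 0` for all `i`. -/
theorem exists_dual_apply_eq_zero_forall_apply_ne_zero (x : ι → End K V)
    (hx : ∀ i c, x i ≠ algebraMap K (End K V) c) :
    ∃ (e : V) (φ : Dual K V), φ e = 0 ∧ ∀ i, φ (x i e) ≠ 0 := by
  obtain ⟨e, he⟩ := exists_forall_notMem_span_singleton x hx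
  obtain ⟨φ, hφ⟩ := exists_dual_forall_apply_ne_zero (K := K)
    (fun i => (Submodule.span K {e}).mkQ (x i e)) fun i => by
      rw [Submodule.mkQ_apply, Ne, Submodule.Quotient.mk_eq_zero]
      exact he i
  refine ⟨e, φ ∘ₗ (Submodule.span K {e}).mkQ, ?_, hφ⟩
  rw [LinearMap.comp_apply, Submodule.mkQ_apply,
    (Submodule.Quotient.mk_eq_zero _).2 (Submodule.mem_span_singleton_self e), map_zero]

end Algebra

/-! ### The topology of `ℙ(W)` -/

section Projective

variable {W : Type*} [AddCommGroup W] [Module ℂ W] [TopologicalSpace W]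

theorem continuous_projectivization_mk :
    Continuous fun v : {v : W // v ≠ 0} => Projectivization.mk ℂ v.1 v.2 :=
  continuous_coinduced_rng

theorem compactSpace_projectivization [FiniteDimensional ℂ W] [IsModuleTopology ℂ W] :
    CompactSpace (ℙ ℂ W) := by
  let L : EuclideanSpace ℂ (Fin (Module.finrank ℂ W)) ≃ₗ[ℂ] W :=
    LinearEquiv.ofFinrankEq _ _ (by simp)
  have : ContinuousAdd W := IsModuleTopology.toContinuousAdd ℂ W
  have : IsTopologicalAddGroup W := IsModuleTopology.topologicalAddGroup ℂ W
  have hL : Continuous L := L.toLinearMap.continuous_of_finiteDimensional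
  -- The unit sphere of a Euclidean model of `W` is compact and maps onto `ℙ(W)`.
  have hL0 (v : Metric.sphere (0 : EuclideanSpace ℂ (Fin (Module.finrank ℂ W))) 1) : L v ≠ 0 :=
    L.map_ne_zero_iff.2 (ne_zero_of_mem_unit_sphere v)
  let F : Metric.sphere (0 : EuclideanSpace ℂ (Fin (Module.finrank ℂ W))) 1 → ℙ ℂ W := fun v =>
    Projectivization.mk ℂ (L v) (hL0 v)
  have hF : Continuous F := continuous_projectivization_mk.comp
    ((hL.comp continuous_subtype_val).subtype_mk hL0)
  have hsurj : Function.Surjective F := by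
    intro p
    induction p with | h v hv =>
    have hv' : L.symm v ≠ 0 := L.symm.map_ne_zero_iff.2 hv
    refine ⟨⟨((‖L.symm v‖ : ℂ)⁻¹) • L.symm v, ?_⟩, ?_⟩
    · rw [mem_sphere_zero_iff_norm]
      exact norm_smul_inv_norm hv'
    · refine (Projectivization.mk_eq_mk_iff' ℂ _ _ _ _).2 ⟨(‖L.symm v‖ : ℂ)⁻¹, ?_⟩
      simp
  exact hsurj.compactSpace hF

end Projective

/-! ### Continuity of the adjoint action -/

section AdjointAction

variable {V : Type*} [AddCommGroup V] [Module ℂ V]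

instance slAlgebraIsModuleTopology : IsModuleTopology ℂ (slAlgebra V) := ⟨rfl⟩

theorem coe_adjoint_smul (g : SpecialLinearGroup ℂ V) (x : slAlgebra V) :
    ((g • x : slAlgebra V) : Module.End ℂ V) =
      ((g : V ≃ₗ[ℂ] V) : Module.End ℂ V) * (x : Module.End ℂ V) *
        (((g⁻¹ : SpecialLinearGroup ℂ V) : V ≃ₗ[ℂ] V) : Module.End ℂ V) :=
  rfl

variable [FiniteDimensional ℂ V]

theorem continuous_adjoint_smul (x : slAlgebra V) :
    Continuous fun g : SpecialLinearGroup ℂ V => g • x := by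
  let b := Module.finBasis ℂ V
  let : TopologicalSpace (Module.End ℂ V) := moduleTopology ℂ (Module.End ℂ V)
  have : IsModuleTopology ℂ (Module.End ℂ V) := ⟨rfl⟩
  have hM : Continuous fun g : SpecialLinearGroup ℂ V =>
      LinearMap.toMatrix b b ((g : V ≃ₗ[ℂ] V) : Module.End ℂ V) :=
    (IsModuleTopology.continuous_of_linearMap (LinearMap.toMatrix b b).toLinearMap).comp
      continuous_induced_dom
  -- Inverses in `SL(V)` are adjugates, so they depend continuously on the group element.
  have hinv (g : SpecialLinearGroup ℂ V) :
      LinearMap.toMatrix b b (((g⁻¹ : SpecialLinearGroup ℂ V) : V ≃ₗ[ℂ] V) : Module.End ℂ V) =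
        (LinearMap.toMatrix b b ((g : V ≃ₗ[ℂ] V) : Module.End ℂ V)).adjugate := by
    have hdet : (LinearMap.toMatrix b b ((g : V ≃ₗ[ℂ] V) : Module.End ℂ V)).det = 1 := by
      rw [LinearMap.det_toMatrix, ← LinearEquiv.coe_det, g.2, Units.val_one]
    have hmul : LinearMap.toMatrix b b ((g : V ≃ₗ[ℂ] V) : Module.End ℂ V) *
        LinearMap.toMatrix b b
          (((g⁻¹ : SpecialLinearGroup ℂ V) : V ≃ₗ[ℂ] V) : Module.End ℂ V) = 1 := by
      rw [← LinearMap.toMatrix_mul, ← LinearMap.toMatrix_one b]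
      congr 1
      ext v
      exact (g : V ≃ₗ[ℂ] V).apply_symm_apply v
    rw [← Matrix.inv_eq_right_inv hmul, Matrix.inv_def, hdet, Ring.inverse_one, one_smul]
  -- A linear retraction of `Matrix` onto `sl(V)`, continuous since it is linear.
  obtain ⟨r, hr⟩ := (slAlgebra V).subtype.exists_leftInverse_of_injective
    (slAlgebra V).ker_subtype
  let R : Matrix (Fin (Module.finrank ℂ V)) (Fin (Module.finrank ℂ V)) ℂ →ₗ[ℂ] slAlgebra V :=
    r ∘ₗ (LinearMap.toMatrix b b).symm.toLinearMap
  have : ContinuousAdd (slAlgebra V) := IsModuleTopology.toContinuousAdd ℂ _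
  have : IsTopologicalAddGroup (slAlgebra V) := IsModuleTopology.topologicalAddGroup ℂ _
  have hR : Continuous R := R.continuous_of_finiteDimensional
  have key : (fun g : SpecialLinearGroup ℂ V => g • x) = fun g : SpecialLinearGroup ℂ V =>
      R (LinearMap.toMatrix b b ((g : V ≃ₗ[ℂ] V) : Module.End ℂ V) *
        LinearMap.toMatrix b b (x : Module.End ℂ V) *
        (LinearMap.toMatrix b b ((g : V ≃ₗ[ℂ] V) : Module.End ℂ V)).adjugate) := by
    funext g
    rw [← hinv, ← LinearMap.toMatrix_mul, ← LinearMap.toMatrix_mul, ← coe_adjoint_smul]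
    simp only [R, LinearMap.comp_apply, LinearEquiv.coe_coe, LinearEquiv.symm_apply_apply]
    exact (LinearMap.congr_fun hr (g • x)).symm
  rw [key]
  exact hR.comp ((hM.mul continuous_const).mul hM.matrix_adjugate)

theorem continuous_smul_projectivization (p : ℙ ℂ (slAlgebra V)) :
    Continuous fun g : SpecialLinearGroup ℂ V => g • p := by
  induction p with | h x hx =>
  exact continuous_projectivization_mk.comp ((continuous_adjoint_smul x).subtype_mk
    fun g => (smul_ne_zero_iff_ne g).2 hx)

end AdjointAction

/-! ### Degeneration of orbits to rank-one nilpotents -/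

section Degeneration

open Module

variable {V : Type*} [AddCommGroup V] [Module ℂ V]

theorem ne_algebraMap_of_mem_slAlgebra [FiniteDimensional ℂ V] {x : slAlgebra V} (hx : x ≠ 0)
    (c : ℂ) : (x : End ℂ V) ≠ algebraMap ℂ (End ℂ V) c := by
  intro h
  have htr := mem_slAlgebra.1 x.2
  rw [h, Algebra.algebraMap_eq_smul_one, map_smul, LinearMap.trace_one, smul_eq_mul,
    mul_eq_zero, Nat.cast_eq_zero] at htr
  refine hx (Subtype.ext ?_)
  rcases htr with rfl | h0
  · rw [h, map_zero]
    rfl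
  · have := finrank_zero_iff.1 h0
    exact Subsingleton.elim _ _

/-- The rank-one nilpotent endomorphism `v ↦ φ(v) e`, where `φ e = 0`, as an element of
`sl(V)`. -/
noncomputable def rankOneNilpotent [FiniteDimensional ℂ V] {e : V} {φ : Dual ℂ V}
    (h : φ e = 0) : slAlgebra V :=
  ⟨φ.smulRight e, mem_slAlgebra.2 (by rw [LinearMap.trace_smulRight, h])⟩

variable [FiniteDimensional ℂ V] {e : V} {φ : Dual ℂ V}

theorem rankOneNilpotent_ne_zero (h : φ e = 0) {v : V} (hv : φ v ≠ 0) (he : e ≠ 0) :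
    rankOneNilpotent h ≠ 0 := by
  intro h0
  have : φ v • e = 0 := LinearMap.congr_fun (congrArg Subtype.val h0) v
  exact (smul_ne_zero hv he) this

/-- The commutator of `e ⊗ φ` with `x`, as an element of `sl(V)`. -/
noncomputable def rankOneCommutator (e : V) (φ : Dual ℂ V) (x : slAlgebra V) : slAlgebra V :=
  ⟨φ.smulRight e * (x : End ℂ V) - (x : End ℂ V) * φ.smulRight e, mem_slAlgebra.2 (by
    rw [map_sub, LinearMap.trace_mul_comm, sub_self])⟩

/-- The conjugate of `x` by the transvection with parameter `s⁻¹`, rescaled by `s²`, extends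
polynomially to `s = 0`. -/
theorem exists_smul_eq_smul_add (h : φ e = 0) (x : slAlgebra V) {s : ℂ} (hs : s ≠ 0) :
    ∃ g : SpecialLinearGroup ℂ V,
      s ^ 2 • x + s • rankOneCommutator e φ x - φ ((x : End ℂ V) e) • rankOneNilpotent h =
        s ^ 2 • (g • x) := by
  have h' : φ (s⁻¹ • e) = 0 := by rw [map_smul, h, smul_zero]
  refine ⟨⟨LinearEquiv.transvection h', LinearEquiv.transvection.det_eq_one h'⟩, ?_⟩
  refine Subtype.ext (LinearMap.ext fun v => ?_)
  change s ^ 2 • (x : End ℂ V) v + s • (φ ((x : End ℂ V) v) • e - (x : End ℂ V) (φ v • e)) -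
      φ ((x : End ℂ V) e) • φ v • e =
    s ^ 2 • ((x : End ℂ V) (v + φ v • -(s⁻¹ • e)) +
      φ ((x : End ℂ V) (v + φ v • -(s⁻¹ • e))) • s⁻¹ • e)
  simp only [map_add, map_smul, map_neg, smul_eq_mul]
  match_scalars <;> field_simp
  ring

/-- If `φ (x e) ≠ 0`, the line of `e ⊗ φ` lies in the closure of the orbit of `[x]`: a continuous
function that is constant on the orbit takes the same value there. -/
theorem apply_mk_rankOne_eq_of_smul_invariant {f : ℙ ℂ (slAlgebra V) → ℝ} (hf : Continuous f)
    {x : slAlgebra V} (hx : x ≠ 0)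
    (hinv : ∀ g : SpecialLinearGroup ℂ V,
      f (g • Projectivization.mk ℂ x hx) = f (Projectivization.mk ℂ x hx))
    (h : φ e = 0) (hxe : φ ((x : End ℂ V) e) ≠ 0) (hN : rankOneNilpotent h ≠ 0) :
    f (Projectivization.mk ℂ (rankOneNilpotent h) hN) = f (Projectivization.mk ℂ x hx) := by
  let w : ℂ → slAlgebra V := fun s =>
    s ^ 2 • x + s • rankOneCommutator e φ x - φ ((x : End ℂ V) e) • rankOneNilpotent h
  have : ContinuousAdd (slAlgebra V) := IsModuleTopology.toContinuousAdd ℂ _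
  have : IsTopologicalAddGroup (slAlgebra V) := IsModuleTopology.topologicalAddGroup ℂ _
  have hwc : Continuous w := by fun_prop
  have hw_smul {s : ℂ} (hs : s ≠ 0) : ∃ g : SpecialLinearGroup ℂ V, w s = s ^ 2 • (g • x) :=
    exists_smul_eq_smul_add h x hs
  have hw0 : w 0 = -φ ((x : End ℂ V) e) • rankOneNilpotent h := by
    simp only [w, zero_pow two_ne_zero, zero_smul, add_zero, zero_sub]
    exact (neg_smul _ _).symm
  have hw (s : ℂ) : w s ≠ 0 := by
    rcases eq_or_ne s 0 with rfl | hs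
    · rw [hw0]
      exact smul_ne_zero (neg_ne_zero.2 hxe) hN
    · obtain ⟨g, hg⟩ := hw_smul hs
      rw [hg]
      exact smul_ne_zero (pow_ne_zero 2 hs) ((smul_ne_zero_iff_ne g).2 hx)
  have hcont : Continuous fun s => f (Projectivization.mk ℂ (w s) (hw s)) :=
    hf.comp (continuous_projectivization_mk.comp (hwc.subtype_mk hw))
  have hconst : (fun s => f (Projectivization.mk ℂ (w s) (hw s))) =
      fun _ => f (Projectivization.mk ℂ x hx) := by
    refine hcont.ext_on (dense_compl_singleton (0 : ℂ)) continuous_const fun s hs => ?_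
    obtain ⟨g, hg⟩ := hw_smul hs
    rw [← hinv g, Projectivization.smul_mk]
    exact congrArg f ((Projectivization.mk_eq_mk_iff' ℂ _ _ _ _).2 ⟨s ^ 2, hg.symm⟩)
  rw [← congrFun hconst 0]
  refine congrArg f ((Projectivization.mk_eq_mk_iff' ℂ _ _ _ _).2
    ⟨(-φ ((x : End ℂ V) e))⁻¹, ?_⟩)
  rw [hw0, smul_smul, inv_mul_cancel₀ (neg_ne_zero.2 hxe), one_smul]

/-- Any two orbit closures in `ℙ(sl(V))` intersect: a continuous function that is constant on each
of two orbits takes the same value on both. -/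
theorem apply_eq_apply_of_smul_invariant {f : ℙ ℂ (slAlgebra V) → ℝ} (hf : Continuous f)
    {p q : ℙ ℂ (slAlgebra V)} (hp : ∀ g : SpecialLinearGroup ℂ V, f (g • p) = f p)
    (hq : ∀ g : SpecialLinearGroup ℂ V, f (g • q) = f q) : f p = f q := by
  induction p with | h x hx =>
  induction q with | h y hy =>
  obtain ⟨e, φ, h, hxy⟩ := exists_dual_apply_eq_zero_forall_apply_ne_zero
    ![(x : End ℂ V), (y : End ℂ V)] (Fin.forall_fin_two.2
      ⟨ne_algebraMap_of_mem_slAlgebra hx, ne_algebraMap_of_mem_slAlgebra hy⟩)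
  have hxe : φ ((x : End ℂ V) e) ≠ 0 := hxy 0
  have hye : φ ((y : End ℂ V) e) ≠ 0 := hxy 1
  have hN : rankOneNilpotent h ≠ 0 := rankOneNilpotent_ne_zero h hxe (by
    rintro rfl
    simp at hxe)
  rw [← apply_mk_rankOne_eq_of_smul_invariant hf hx hp h hxe hN,
    apply_mk_rankOne_eq_of_smul_invariant hf hy hq h hye hN]

end Degeneration

/-! ### The Liouville property -/

theorem mainTheorem4 (V : Type*) [AddCommGroup V] [Module ℂ V] [FiniteDimensional ℂ V] :
    GroupAction.GroupHasLiouvilleProperty (SpecialLinearGroup ℂ V) (ℙ ℂ (slAlgebra V)) := by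
  intro μ hprob hirr f hf hbdd hμ g _ x
  have := compactSpace_projectivization (W := slAlgebra V)
  have : Nonempty (ℙ ℂ (slAlgebra V)) := ⟨x⟩
  obtain ⟨p, -, hp⟩ := isCompact_univ.exists_isMaxOn Set.univ_nonempty hf.continuousOn
  obtain ⟨q, -, hq⟩ := isCompact_univ.exists_isMinOn Set.univ_nonempty hf.continuousOn
  have hmax (y) : f y ≤ f p := hp (Set.mem_univ y)
  have hmin (y) : f q ≤ f y := hq (Set.mem_univ y)
  have hpinv := hμ.apply_smul_eq_of_isMax hirr continuous_smul_projectivization hf hbdd hmax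
  -- The maximum principle for `-f` is the minimum principle for `f`.
  have hμ' : GroupAction.HasMeanValueProperty μ (-f) := fun y => by
    simp only [Pi.neg_apply, integral_neg, hμ y]
  have hqinv (g : SpecialLinearGroup ℂ V) : f (g • q) = f q :=
    neg_injective (hμ'.apply_smul_eq_of_isMax hirr continuous_smul_projectivization hf.neg
      (by simpa using hbdd) (fun y => neg_le_neg (hmin y)) g)
  have hpq : f p = f q := apply_eq_apply_of_smul_invariant hf hpinv hqinv
  exact le_antisymm ((hmax _).trans (hpq.trans_le (hmin _)))
    ((hmax _).trans (hpq.trans_le (hmin _)))
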